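/- There is an absolute constant $C>0$ such that the following holds. Let $(Q_2(u),\,u\ge 0)$ be a Bessel process of dimension $2$ started at $0$, that is, a process with almost surely continuous paths that has the law of the Euclidean norm of a standard two-dimensional Brownian motion started at $0$. Let $a,k:(0,\infty)\to(0,\infty)$ be functions with $a(t)\to+\infty$ and $k(t)\to+\infty$ as $t\to+\infty$. Then, for all sufficiently large $t$, $$P\Big(\forall u\in(0,k(t)],\ Q_2^2(u)\le 2e\big[a(t)+4\log\log(e\,k(t)/u)\big]\,u\Big)\ \ge\ 1-C\,e^{-a(t)/2}.$$ -/

import Mathlib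

open MeasureTheory ProbabilityTheory Filter
open scoped NNReal

/-- The law of `(‖B s‖)_{s ∈ I}`, where `B = (B₁, …, B_d)` is a standard `d`-dimensional Brownian
motion started at `0` and `‖·‖` is the Euclidean norm: the coordinates `B_j` are independent, and
each `(B_j s)_{s ∈ I}` is a centered Gaussian vector with covariance `min s t`. -/
noncomputable def besselLaw (d : ℕ) (I : Finset ℝ≥0) : Measure (I → ℝ) :=
  (Measure.pi fun _ : Fin d ↦ BrownianReal.projectiveFamily I).map
    fun x s ↦ √(∑ j, x j s ^ 2)

/-- `Q` is a Bessel process of (integer) dimension `d` started at `0` under `P`: it has almost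
surely continuous paths and its finite-dimensional distributions are those of the Euclidean norm of
a `d`-dimensional standard Brownian motion started at `0`. -/
structure IsBesselProcess {Ω : Type*} [MeasurableSpace Ω] (d : ℕ) (Q : ℝ≥0 → Ω → ℝ)
    (P : Measure Ω) : Prop where
  hasLaw : ∀ I : Finset ℝ≥0, HasLaw (fun ω ↦ I.restrict (Q · ω)) (besselLaw d I) P
  cont : ∀ᵐ ω ∂P, Continuous (Q · ω)

/-!
Reflecting the increments of Brownian motion `B` after a time `t` preserves its law, and if `|B|`
first reaches level `r` at time `t`, then `B` or its reflection is at distance at least `r` from `0`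
at the final time. Hence `max_{u ≤ T} |B u|` has the Gaussian tail of `|B T|` up to a factor `2`,
and a union bound over the coordinates controls the running maximum of `Q ^ 2`.

On the block `k e⁻ⁿ⁻¹ < u ≤ k e⁻ⁿ` the envelope `d e (a + 4 log log (e k / u)) u` is at least
`d (a + 4 log (n + 1)) k e⁻ⁿ`: its factor `e` makes up for replacing `u` by `k e⁻ⁿ`. The running
maximum of `Q ^ 2` up to time `k e⁻ⁿ` exceeds this level with probability at most
`4 d e^(-a/2) / (n + 1) ^ 2`, which is summable over `n`.
-/

section FirstPassage

variable {ι E : Type*}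

variable (E) in
/-- The set of paths whose norm reaches level `r` at time `s` for the first time. -/
def firstPassage [Preorder ι] [Norm E] (r : ℝ) (s : ι) : Set (ι → E) :=
  {x | r ≤ ‖x s‖ ∧ ∀ s' < s, ‖x s'‖ < r}

lemma setOf_exists_le_norm_subset_iUnion_firstPassage [Preorder ι] [WellFoundedLT ι] [Norm E]
    (r : ℝ) : {x : ι → E | ∃ s, r ≤ ‖x s‖} ⊆ ⋃ s, firstPassage E r s := by
  intro x hx
  obtain ⟨s, hs, hmin⟩ := WellFounded.has_min wellFounded_lt {s | r ≤ ‖x s‖} hx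
  exact Set.mem_iUnion.2 ⟨s, hs, fun s' hlt ↦ not_le.1 fun hs' ↦ hmin s' hs' hlt⟩

lemma pairwise_disjoint_firstPassage [LinearOrder ι] [Norm E] (r : ℝ) :
    Pairwise (Function.onFun Disjoint (firstPassage (ι := ι) E r)) := by
  intro s s' hne
  refine Set.disjoint_left.2 fun x hx hx' ↦ ?_
  rcases lt_or_gt_of_ne hne with hlt | hgt
  · exact (hx'.2 s hlt).not_ge hx.1
  · exact (hx.2 s' hgt).not_ge hx'.1

lemma measurableSet_firstPassage [Countable ι] [Preorder ι] [NormedAddCommGroup E]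
    [MeasurableSpace E] [OpensMeasurableSpace E] (r : ℝ) (s : ι) :
    MeasurableSet (firstPassage E r s) := by
  have hnorm (s' : ι) : Measurable fun x : ι → E ↦ ‖x s'‖ := (measurable_pi_apply s').norm
  simp only [firstPassage, Set.ofPred_and, Set.ofPred_forall]
  exact (measurableSet_le measurable_const (hnorm s)).inter
    (.iInter fun s' ↦ .iInter fun _ ↦ measurableSet_lt (hnorm s') measurable_const)

end FirstPassage

section PathReflection

variable {ι E : Type*} [LinearOrder ι] [NormedAddCommGroup E] [NormedSpace ℝ E]

/-- Reflection of a path at time `t`: the path is kept up to time `t`, and its increments after `t`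
change sign. -/
def pathReflection (t : ι) : (ι → E) →L[ℝ] (ι → E) :=
  .pi fun s ↦ (2 : ℝ) • .proj (min s t) - .proj s

lemma pathReflection_apply (t s : ι) (x : ι → E) :
    pathReflection t x s = (2 : ℝ) • x (min s t) - x s := rfl

lemma pathReflection_apply_of_le {s t : ι} (h : s ≤ t) (x : ι → E) :
    pathReflection t x s = x s := by
  rw [pathReflection_apply, min_eq_left h, two_smul, add_sub_cancel_right]

lemma le_norm_pathReflection {s t : ι} (h : t ≤ s) {x : ι → E} {r : ℝ} (ht : r ≤ ‖x t‖)
    (hs : ‖x s‖ ≤ r) : r ≤ ‖pathReflection t x s‖ := by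
  have htri := norm_sub_norm_le ((2 : ℝ) • x t) (x s)
  rw [norm_smul, Real.norm_two] at htri
  rw [pathReflection_apply, min_eq_right h]
  linarith

lemma pathReflection_mem_firstPassage_iff {t : ι} {x : ι → E} {r : ℝ} :
    pathReflection t x ∈ firstPassage E r t ↔ x ∈ firstPassage E r t := by
  have hkeep (s : ι) (hs : s < t) : pathReflection t x s = x s := pathReflection_apply_of_le hs.le x
  simp +contextual only [firstPassage, Set.mem_ofPred_eq, pathReflection_apply_of_le le_rfl, hkeep]

variable [Countable ι] [MeasurableSpace E] [OpensMeasurableSpace E] {μ : Measure (ι → E)}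

lemma measure_firstPassage_le {s T : ι} (hμ : MeasurePreserving (pathReflection s) μ μ)
    (hsT : s ≤ T) (r : ℝ) :
    μ (firstPassage E r s) ≤ 2 * μ (firstPassage E r s ∩ {x | r ≤ ‖x T‖}) := by
  set A := firstPassage E r s ∩ {x | r ≤ ‖x T‖}
  have hA : MeasurableSet A := (measurableSet_firstPassage r s).inter
    (measurableSet_le measurable_const (measurable_pi_apply T).norm)
  have hcover : firstPassage E r s ⊆ A ∪ pathReflection s ⁻¹' A := by
    intro x hx
    rcases le_total r ‖x T‖ with hT | hT
    · exact .inl ⟨hx, hT⟩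
    · exact .inr ⟨pathReflection_mem_firstPassage_iff.2 hx, le_norm_pathReflection hsT hx.1 hT⟩
  calc μ (firstPassage E r s) ≤ μ A + μ (pathReflection s ⁻¹' A) :=
        (measure_mono hcover).trans (measure_union_le _ _)
    _ = 2 * μ A := by rw [hμ.measure_preimage hA.nullMeasurableSet, two_mul]

theorem levy_maximal_ineq [WellFoundedLT ι] {T : ι} (hT : IsTop T)
    (hμ : ∀ s, MeasurePreserving (pathReflection s) μ μ) (r : ℝ) :
    μ {x | ∃ s, r ≤ ‖x s‖} ≤ 2 * μ {x | r ≤ ‖x T‖} := by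
  set D : Set (ι → E) := {x | r ≤ ‖x T‖}
  have hD : MeasurableSet D := measurableSet_le measurable_const (measurable_pi_apply T).norm
  calc μ {x | ∃ s, r ≤ ‖x s‖} ≤ ∑' s, μ (firstPassage E r s) :=
        (measure_mono (setOf_exists_le_norm_subset_iUnion_firstPassage r)).trans
          (measure_iUnion_le _)
    _ ≤ ∑' s, 2 * μ (firstPassage E r s ∩ D) :=
        ENNReal.tsum_le_tsum fun s ↦ measure_firstPassage_le (hμ s) (hT s) r
    _ = 2 * μ (⋃ s, firstPassage E r s ∩ D) := by
        rw [ENNReal.tsum_mul_left, measure_iUnion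
          (fun s s' hne ↦ (pairwise_disjoint_firstPassage r hne).mono
            Set.inter_subset_left Set.inter_subset_left)
          fun s ↦ (measurableSet_firstPassage r s).inter hD]
    _ ≤ 2 * μ D := by
        gcongr
        exact Set.iUnion_subset fun s ↦ Set.inter_subset_right

end PathReflection

section Gaussian

variable {ι : Type*}

lemma memLp_eval_of_isGaussian (μ : Measure (ι → ℝ)) [IsGaussian μ] (i : ι) :
    MemLp (fun x ↦ x i) 2 μ :=
  (IsGaussian.hasGaussianLaw_id.eval i).memLp_two

lemma isGaussian_ext_of_covariance_eval [Finite ι] {μ ν : Measure (ι → ℝ)} [IsGaussian μ]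
    [IsGaussian ν] (hmean : ∀ i, ∫ x, x i ∂μ = ∫ x, x i ∂ν)
    (hcov : ∀ i j, cov[fun x ↦ x i, fun x ↦ x j; μ] = cov[fun x ↦ x i, fun x ↦ x j; ν]) :
    μ = ν := by
  classical
  cases nonempty_fintype ι
  refine Measure.ext_of_charFunDual (funext fun L ↦ ?_)
  let c (i : ι) : ℝ := L fun j ↦ if i = j then 1 else 0
  have hL : ⇑L = fun x ↦ ∑ i, c i * x i := by
    ext x
    simpa [c, mul_comm] using L.toLinearMap.pi_apply_eq_sum_univ x
  have hmeanL (ρ : Measure (ι → ℝ)) [IsGaussian ρ] : ρ[L] = ∑ i, c i * ∫ x, x i ∂ρ := by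
    rw [hL, integral_finsetSum _ fun i _ ↦
      ((memLp_eval_of_isGaussian ρ i).integrable one_le_two).const_mul (c i)]
    simp only [integral_const_mul]
  have hvarL (ρ : Measure (ι → ℝ)) [IsGaussian ρ] :
      Var[L; ρ] = ∑ i, ∑ j, c j * (c i * cov[fun x ↦ x i, fun x ↦ x j; ρ]) := by
    have hmem (i : ι) : MemLp (fun x ↦ c i * x i) 2 ρ :=
      (memLp_eval_of_isGaussian ρ i).const_mul (c i)
    rw [← covariance_self L.continuous.aemeasurable, hL, covariance_fun_sum_fun_sum hmem hmem]
    simp only [covariance_const_mul_left, covariance_const_mul_right]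
  simp only [IsGaussian.charFunDual_eq, integral_complex_ofReal, hmeanL, hvarL, hmean, hcov]

/-- The hypotheses say that the coordinate process is a Gaussian martingale. -/
lemma measurePreserving_pathReflection_of_isGaussian [Finite ι] [LinearOrder ι]
    {μ : Measure (ι → ℝ)} [IsGaussian μ] {m : ℝ} {v : ι → ℝ} (hmean : ∀ i, ∫ x, x i ∂μ = m)
    (hcov : ∀ i j, cov[fun x ↦ x i, fun x ↦ x j; μ] = v (min i j)) (t : ι) :
    MeasurePreserving (pathReflection t) μ μ := by
  cases nonempty_fintype ι
  have hmeas : Measurable (pathReflection (E := ℝ) t) := (pathReflection t).continuous.measurable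
  have hmem := memLp_eval_of_isGaussian μ
  have hint (i : ι) : Integrable (fun x ↦ x i) μ := (hmem i).integrable one_le_two
  refine ⟨hmeas, isGaussian_ext_of_covariance_eval (fun i ↦ ?_) fun i j ↦ ?_⟩
  · rw [integral_map hmeas.aemeasurable (measurable_pi_apply i).aestronglyMeasurable]
    simp only [pathReflection_apply, smul_eq_mul]
    rw [integral_sub ((hint _).const_mul 2) (hint i), integral_const_mul, hmean, hmean]
    ring
  · have hdouble (s : ι) : MemLp (fun x : ι → ℝ ↦ 2 * x s) 2 μ := (hmem s).const_mul 2
    have hreflect (s : ι) : MemLp (fun x : ι → ℝ ↦ 2 * x (min s t) - x s) 2 μ :=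
      (hdouble _).sub (hmem s)
    rw [covariance_map_fun (measurable_pi_apply i).aestronglyMeasurable
      (measurable_pi_apply j).aestronglyMeasurable hmeas.aemeasurable]
    simp only [pathReflection_apply, smul_eq_mul]
    rw [covariance_fun_sub_left (hdouble _) (hmem i) (hreflect j),
      covariance_fun_sub_right (hdouble _) (hdouble _) (hmem j),
      covariance_fun_sub_right (hmem i) (hdouble _) (hmem j)]
    simp only [covariance_const_mul_left, covariance_const_mul_right, hcov]
    rw [← inf_inf_distrib_right, min_right_comm i t j, ← min_assoc i j t]
    ring

end Gaussian

lemma measureReal_le_abs_le_of_hasSubgaussianMGF {Ω : Type*} [MeasurableSpace Ω] {μ : Measure Ω}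
    [IsFiniteMeasure μ] {X : Ω → ℝ} {c : ℝ≥0} (hX : HasSubgaussianMGF X c μ) {r : ℝ}
    (hr : 0 ≤ r) : μ.real {ω | r ≤ |X ω|} ≤ 2 * Real.exp (-r ^ 2 / (2 * c)) := by
  simp only [le_abs, Set.ofPred_or]
  calc μ.real ({ω | r ≤ X ω} ∪ {ω | r ≤ -X ω})
      ≤ μ.real {ω | r ≤ X ω} + μ.real {ω | r ≤ -X ω} := measureReal_union_le _ _
    _ ≤ Real.exp (-r ^ 2 / (2 * c)) + Real.exp (-r ^ 2 / (2 * c)) :=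
        add_le_add (hX.measure_ge_le hr) (hX.neg.measure_ge_le hr)
    _ = 2 * Real.exp (-r ^ 2 / (2 * c)) := (two_mul _).symm

lemma hasSubgaussianMGF_id_gaussianReal (v : ℝ≥0) : HasSubgaussianMGF id v (gaussianReal 0 v) where
  integrable_exp_mul := integrable_exp_mul_gaussianReal
  mgf_le t := by simp [mgf_id_gaussianReal]

lemma projectiveFamily_exists_le_abs_le {I : Finset ℝ≥0} {T : I} (hT : IsTop T) {r : ℝ}
    (hr : 0 ≤ r) :
    BrownianReal.projectiveFamily I {x | ∃ s, r ≤ |x s|} ≤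
      ENNReal.ofReal (4 * Real.exp (-r ^ 2 / (2 * T.1))) := by
  have hreflect (s : I) : MeasurePreserving (pathReflection s) (BrownianReal.projectiveFamily I)
      (BrownianReal.projectiveFamily I) :=
    measurePreserving_pathReflection_of_isGaussian (v := fun s ↦ (s.1 : ℝ))
      (BrownianReal.integral_eval_projectiveFamily I)
      (fun i j ↦ by
        rw [BrownianReal.covariance_eval_projectiveFamily,
          (Subtype.mono_coe (· ∈ I)).map_min, NNReal.coe_min]) s
  have hmarginal : BrownianReal.projectiveFamily I {x | r ≤ |x T|} =
      gaussianReal 0 T {y | r ≤ |y|} :=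
    (BrownianReal.measurePreserving_eval_projectiveFamily T).measure_preimage
      (measurableSet_le measurable_const measurable_id.abs).nullMeasurableSet
  calc BrownianReal.projectiveFamily I {x | ∃ s, r ≤ |x s|}
      ≤ 2 * BrownianReal.projectiveFamily I {x | r ≤ |x T|} :=
        levy_maximal_ineq hT hreflect r
    _ = ENNReal.ofReal (2 * (gaussianReal 0 T).real {y | r ≤ |y|}) := by
        rw [hmarginal, ENNReal.ofReal_mul zero_le_two, ENNReal.ofReal_ofNat, ofReal_measureReal]
    _ ≤ ENNReal.ofReal (2 * (2 * Real.exp (-r ^ 2 / (2 * T.1)))) := by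
        gcongr
        exact measureReal_le_abs_le_of_hasSubgaussianMGF (hasSubgaussianMGF_id_gaussianReal T) hr
    _ = ENNReal.ofReal (4 * Real.exp (-r ^ 2 / (2 * T.1))) := by congr 1; ring

section BesselLaw

variable {d : ℕ} {I : Finset ℝ≥0}

lemma measurable_sqrt_sum_sq :
    Measurable fun (x : Fin d → I → ℝ) (s : I) ↦ √(∑ j, x j s ^ 2) := by
  fun_prop

instance isProbabilityMeasure_besselLaw : IsProbabilityMeasure (besselLaw d I) :=
  Measure.isProbabilityMeasure_map measurable_sqrt_sum_sq.aemeasurable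

lemma measurableSet_exists_lt_sq (c : ℝ) : MeasurableSet {y : I → ℝ | ∃ s, c < y s ^ 2} :=
  measurableSet_setOfPred.2 <| .exists fun s ↦ measurableSet_setOfPred.1 <|
    measurableSet_lt measurable_const ((measurable_pi_apply s).pow_const 2)

lemma besselLaw_exists_lt_sq_le {T : I} (hT : IsTop T) {R : ℝ} (hR : 0 ≤ R) :
    besselLaw d I {y | ∃ s, d * R < y s ^ 2} ≤
      ENNReal.ofReal (4 * d * Real.exp (-R / (2 * T.1))) := by
  set A : Set (I → ℝ) := {x | ∃ s, √R ≤ |x s|}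
  have hA : MeasurableSet A := measurableSet_setOfPred.2 <| .exists fun s ↦
    measurableSet_setOfPred.1 <| measurableSet_le measurable_const (measurable_pi_apply s).abs
  have hcover : (fun (x : Fin d → I → ℝ) s ↦ √(∑ j, x j s ^ 2)) ⁻¹' {y | ∃ s, d * R < y s ^ 2} ⊆
      ⋃ j, Function.eval j ⁻¹' A := by
    rintro x ⟨s, hs⟩
    have hsum : ∑ _j : Fin d, R < ∑ j, x j s ^ 2 := by
      rw [Real.sq_sqrt (by positivity)] at hs
      simpa using hs
    obtain ⟨j, -, hj⟩ := Finset.exists_lt_of_sum_lt hsum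
    exact Set.mem_iUnion.2 ⟨j, s, Real.sqrt_le_iff.2 ⟨abs_nonneg _, (sq_abs (x j s)).symm ▸ hj.le⟩⟩
  rw [besselLaw, Measure.map_apply measurable_sqrt_sum_sq (measurableSet_exists_lt_sq _)]
  set ν := Measure.pi fun _ : Fin d ↦ BrownianReal.projectiveFamily I
  have hcoord (j : Fin d) :
      ν (Function.eval j ⁻¹' A) ≤ ENNReal.ofReal (4 * Real.exp (-R / (2 * T.1))) := by
    rw [(measurePreserving_eval (fun _ : Fin d ↦ BrownianReal.projectiveFamily I)
      j).measure_preimage hA.nullMeasurableSet]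
    simpa only [Real.sq_sqrt hR] using projectiveFamily_exists_le_abs_le hT (Real.sqrt_nonneg R)
  calc ν _ ≤ ∑ j, ν (Function.eval j ⁻¹' A) :=
        (measure_mono hcover).trans (measure_iUnion_fintype_le _ _)
    _ ≤ ∑ _j : Fin d, ENNReal.ofReal (4 * Real.exp (-R / (2 * T.1))) :=
        Finset.sum_le_sum fun j _ ↦ hcoord j
    _ = ENNReal.ofReal (4 * d * Real.exp (-R / (2 * T.1))) := by
        rw [← ENNReal.ofReal_sum_of_nonneg fun j _ ↦ by positivity, Fin.sum_const, nsmul_eq_mul]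
        congr 1
        ring

end BesselLaw

lemma measure_exists_mem_le_of_forall_finset {ι Ω E : Type*} [TopologicalSpace ι]
    [TopologicalSpace.SeparableSpace ι] [TopologicalSpace E] [MeasurableSpace Ω] {P : Measure Ω}
    {X : ι → Ω → E} (hX : ∀ᵐ ω ∂P, Continuous (X · ω)) {U : Set E} (hU : IsOpen U) {c : ENNReal}
    (hc : ∀ F : Finset ι, P {ω | ∃ i ∈ F, X i ω ∈ U} ≤ c) : P {ω | ∃ i, X i ω ∈ U} ≤ c := by
  obtain ⟨D, hDcount, hD⟩ := TopologicalSpace.exists_countable_dense ι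
  have := hDcount.to_subtype
  let A (F : Finset D) : Set Ω := {ω | ∃ i ∈ F, X i ω ∈ U}
  have hmono : Monotone A := fun F G h ω ⟨i, hi, hiU⟩ ↦ ⟨i, h hi, hiU⟩
  have hae : {ω | ∃ i, X i ω ∈ U} ≤ᵐ[P] ⋃ F, A F := by
    filter_upwards [hX] with ω hω hex
    obtain ⟨i, hiD, hi⟩ := hD.exists_mem_open (hU.preimage hω) hex
    exact Set.mem_iUnion.2 ⟨{⟨i, hiD⟩}, ⟨i, hiD⟩, Finset.mem_singleton_self _, hi⟩
  calc P {ω | ∃ i, X i ω ∈ U} ≤ P (⋃ F, A F) := measure_mono_ae hae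
    _ = ⨆ F, P (A F) := hmono.directed_le.measure_iUnion
    _ ≤ c := iSup_le fun F ↦ by
        simpa [A] using hc (F.map (Function.Embedding.subtype (· ∈ D)))

lemma hasSum_one_div_nat_add_one_sq :
    HasSum (fun n : ℕ ↦ 1 / ((n : ℝ) + 1) ^ 2) (Real.pi ^ 2 / 6) := by
  simpa using (hasSum_nat_add_iff' 1).2 hasSum_zeta_two

lemma exists_nat_le_mul_exp_neg {a k u : ℝ} (ha : 0 ≤ a) (hu : 0 < u) (huk : u ≤ k) :
    ∃ n : ℕ, u ≤ k * Real.exp (-n) ∧ (a + 4 * Real.log (n + 1)) * (k * Real.exp (-n)) ≤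
      Real.exp 1 * (a + 4 * Real.log (Real.log (Real.exp 1 * k / u))) * u := by
  have hk : 0 < k := hu.trans_le huk
  set L := Real.log (k / u)
  have hL : 0 ≤ L := Real.log_nonneg ((one_le_div hu).2 huk)
  have hku : k = u * Real.exp L := by rw [Real.exp_log (by positivity), mul_div_cancel₀ k hu.ne']
  have hscale (n : ℕ) : k * Real.exp (-n) = Real.exp (L - n) * u := by
    rw [hku, sub_eq_add_neg, Real.exp_add]; ring
  refine ⟨⌊L⌋₊, ?_, ?_⟩
  · rw [hscale]
    exact le_mul_of_one_le_left hu.le (Real.one_le_exp (sub_nonneg.2 (Nat.floor_le hL)))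
  · have hloglog : Real.log (⌊L⌋₊ + 1) ≤ Real.log (Real.log (Real.exp 1 * k / u)) := by
      rw [mul_div_assoc, Real.log_mul (Real.exp_ne_zero _) (by positivity), Real.log_exp, add_comm]
      gcongr
      exact Nat.floor_le hL
    have hexp : Real.exp (L - ⌊L⌋₊) ≤ Real.exp 1 :=
      Real.exp_le_exp.2 (sub_left_le_of_le_add (Nat.lt_floor_add_one L).le)
    have hlog : 0 ≤ Real.log ((⌊L⌋₊ : ℝ) + 1) := Real.log_nonneg (by simp)
    calc (a + 4 * Real.log (⌊L⌋₊ + 1)) * (k * Real.exp (-⌊L⌋₊))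
        = Real.exp (L - ⌊L⌋₊) * (a + 4 * Real.log (⌊L⌋₊ + 1)) * u := by rw [hscale]; ring
      _ ≤ _ := by gcongr

lemma exp_neg_add_four_mul_log_div_two (a : ℝ) {x : ℝ} (hx : 0 < x) :
    Real.exp (-(a + 4 * Real.log x) / 2) = Real.exp (-a / 2) * (1 / x ^ 2) := by
  rw [show -(a + 4 * Real.log x) / 2 = -a / 2 - (2 : ℕ) * Real.log x by push_cast; ring,
    Real.exp_sub, Real.exp_nat_mul, Real.exp_log hx, mul_one_div]

namespace IsBesselProcess

variable {Ω : Type*} [MeasurableSpace Ω] {d : ℕ} {P : Measure Ω} {Q : ℝ≥0 → Ω → ℝ}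

lemma isProbabilityMeasure (hQ : IsBesselProcess d Q P) : IsProbabilityMeasure P :=
  (hQ.hasLaw ∅).isProbabilityMeasure

lemma measure_exists_mem_finset_lt_sq_le (hQ : IsBesselProcess d Q P) {I : Finset ℝ≥0} {T : ℝ≥0}
    (hT : IsGreatest (I : Set ℝ≥0) T) {R : ℝ} (hR : 0 ≤ R) :
    P {ω | ∃ s ∈ I, d * R < Q s ω ^ 2} ≤ ENNReal.ofReal (4 * d * Real.exp (-R / (2 * T))) := by
  have hbound := besselLaw_exists_lt_sq_le (d := d) (T := ⟨T, hT.1⟩) (fun s ↦ hT.2 s.2) hR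
  rw [← (hQ.hasLaw I).map_eq, Measure.map_apply_of_aemeasurable (hQ.hasLaw I).aemeasurable
    (measurableSet_exists_lt_sq _)] at hbound
  simpa using hbound

theorem measure_exists_le_lt_sq_le (hQ : IsBesselProcess d Q P) (T : ℝ≥0) {R : ℝ} (hR : 0 ≤ R) :
    P {ω | ∃ u ≤ T, d * R < Q u ω ^ 2} ≤ ENNReal.ofReal (4 * d * Real.exp (-R / (2 * T))) := by
  have hcont : ∀ᵐ ω ∂P, Continuous fun u : Set.Iic T ↦ Q u ω :=
    hQ.cont.mono fun ω hω ↦ hω.comp continuous_subtype_val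
  have hopen : IsOpen {q : ℝ | d * R < q ^ 2} := isOpen_lt continuous_const (continuous_pow 2)
  have hfinset (F : Finset (Set.Iic T)) :
      P {ω | ∃ u ∈ F, Q u ω ∈ {q : ℝ | d * R < q ^ 2}} ≤
        ENNReal.ofReal (4 * d * Real.exp (-R / (2 * T))) := by
    have hT : IsGreatest (insert T (F.image Subtype.val) : Finset ℝ≥0) T := by
      refine ⟨by simp, fun s hs ↦ ?_⟩
      rcases Finset.mem_insert.1 (Finset.mem_coe.1 hs) with rfl | hs
      · exact le_rfl
      · obtain ⟨u, -, rfl⟩ := Finset.mem_image.1 hs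
        exact u.2
    refine (measure_mono ?_).trans (hQ.measure_exists_mem_finset_lt_sq_le hT hR)
    rintro ω ⟨u, hu, hlt⟩
    exact ⟨u, Finset.mem_insert_of_mem (Finset.mem_image_of_mem _ hu), hlt⟩
  simpa using measure_exists_mem_le_of_forall_finset hcont hopen hfinset

lemma measure_exists_nat_lt_sq_le (hQ : IsBesselProcess d Q P) {a k : ℝ} (ha : 0 ≤ a)
    (hk : 0 < k) :
    P {ω | ∃ n : ℕ, ∃ u : ℝ≥0, u ≤ k * Real.exp (-n) ∧
        d * ((a + 4 * Real.log (n + 1)) * (k * Real.exp (-n))) < Q u ω ^ 2} ≤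
      ENNReal.ofReal (2 * Real.pi ^ 2 / 3 * d * Real.exp (-a / 2)) := by
  let A (n : ℕ) : Set Ω := {ω | ∃ u : ℝ≥0, u ≤ k * Real.exp (-n) ∧
    d * ((a + 4 * Real.log (n + 1)) * (k * Real.exp (-n))) < Q u ω ^ 2}
  have hA (n : ℕ) :
      P (A n) ≤ ENNReal.ofReal (4 * d * Real.exp (-a / 2) * (1 / ((n : ℝ) + 1) ^ 2)) := by
    have hT : 0 < k * Real.exp (-n) := by positivity
    have hlog : 0 ≤ Real.log ((n : ℝ) + 1) := Real.log_nonneg (by simp)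
    have htail := hQ.measure_exists_le_lt_sq_le (k * Real.exp (-n)).toNNReal
      (R := (a + 4 * Real.log (n + 1)) * (k * Real.exp (-n))) (by positivity)
    simp only [Real.le_toNNReal_iff_coe_le hT.le, Real.coe_toNNReal _ hT.le] at htail
    rwa [← neg_mul, mul_div_mul_right _ _ hT.ne',
      exp_neg_add_four_mul_log_div_two a (by positivity), ← mul_assoc (4 * (d : ℝ))] at htail
  have hsum := hasSum_one_div_nat_add_one_sq.mul_left (4 * d * Real.exp (-a / 2))
  calc P {ω | ∃ n, ω ∈ A n} ≤ ∑' n, P (A n) := by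
        rw [Set.ofPred_exists]; exact measure_iUnion_le A
    _ ≤ ∑' n : ℕ, ENNReal.ofReal (4 * d * Real.exp (-a / 2) * (1 / ((n : ℝ) + 1) ^ 2)) :=
        ENNReal.tsum_le_tsum hA
    _ = ENNReal.ofReal (2 * Real.pi ^ 2 / 3 * d * Real.exp (-a / 2)) := by
        rw [← ENNReal.ofReal_tsum_of_nonneg (fun n ↦ by positivity) hsum.summable, hsum.tsum_eq]
        congr 1
        ring

end IsBesselProcess

theorem lemma7p5_general {Ω : Type*} [MeasurableSpace Ω] {d : ℕ} {P : Measure Ω}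
    {Q : ℝ≥0 → Ω → ℝ} (hQ : IsBesselProcess d Q P) {a k : ℝ} (ha : 0 ≤ a) (hk : 0 < k) :
    1 - 2 * Real.pi ^ 2 / 3 * d * Real.exp (-a / 2) ≤
      P.real {ω | ∀ u : ℝ≥0, 0 < u → (u : ℝ) ≤ k →
        Q u ω ^ 2 ≤ d * Real.exp 1 * (a + 4 * Real.log (Real.log (Real.exp 1 * k / u))) * u} := by
  have := hQ.isProbabilityMeasure
  set G := {ω | ∀ u : ℝ≥0, 0 < u → (u : ℝ) ≤ k →
    Q u ω ^ 2 ≤ d * Real.exp 1 * (a + 4 * Real.log (Real.log (Real.exp 1 * k / u))) * u}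
  have hbad : Gᶜ ⊆ {ω | ∃ n : ℕ, ∃ u : ℝ≥0, u ≤ k * Real.exp (-n) ∧
      d * ((a + 4 * Real.log (n + 1)) * (k * Real.exp (-n))) < Q u ω ^ 2} := by
    intro ω hω
    obtain ⟨u, hu, huk, hlt⟩ : ∃ u : ℝ≥0, 0 < u ∧ (u : ℝ) ≤ k ∧
        d * Real.exp 1 * (a + 4 * Real.log (Real.log (Real.exp 1 * k / u))) * u < Q u ω ^ 2 := by
      simpa [G] using hω
    obtain ⟨n, hun, hn⟩ := exists_nat_le_mul_exp_neg ha (NNReal.coe_pos.2 hu) huk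
    refine ⟨n, u, hun, lt_of_le_of_lt ?_ hlt⟩
    simpa only [mul_assoc] using mul_le_mul_of_nonneg_left hn d.cast_nonneg
  have hGc : P.real Gᶜ ≤ 2 * Real.pi ^ 2 / 3 * d * Real.exp (-a / 2) :=
    ENNReal.toReal_le_of_le_ofReal (by positivity)
      ((measure_mono hbad).trans (hQ.measure_exists_nat_lt_sq_le ha hk))
  have hone : 1 ≤ P.real G + P.real Gᶜ := by
    simpa using measureReal_union_le (μ := P) G Gᶜ
  linarith

theorem lemma7p5 :
    ∃ C : ℝ, 0 < C ∧
      ∀ {Ω : Type*} [MeasurableSpace Ω] (P : Measure Ω) [IsProbabilityMeasure P]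
        (Q : ℝ≥0 → Ω → ℝ), IsBesselProcess 2 Q P →
      ∀ a k : ℝ → ℝ, (∀ t, 0 < t → 0 < a t) → (∀ t, 0 < t → 0 < k t) →
        Tendsto a atTop atTop → Tendsto k atTop atTop →
      ∀ᶠ t in atTop,
        1 - C * Real.exp (-(a t) / 2) ≤
          P.real {ω | ∀ u : ℝ≥0, 0 < u → (u : ℝ) ≤ k t →
            Q u ω ^ 2 ≤
              2 * Real.exp 1 * (a t + 4 * Real.log (Real.log (Real.exp 1 * k t / u))) * u} := by
  refine ⟨2 * Real.pi ^ 2 / 3 * 2, by positivity, fun P _ Q hQ a k ha hk _ _ ↦ ?_⟩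
  filter_upwards [eventually_gt_atTop 0] with t ht
  exact_mod_cast lemma7p5_general hQ (ha t ht).le (hk t ht)
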